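/- Let $(E,+,\le)$ be a non-trivial totally ordered abelian group such that (*) for all $a<b$ in $E$ there is $c\in E$ with $a<c<b$; (**) for all $a,b\in E$, $a\le b \iff a-b\le 0$ (that is, the order is translation invariant); and suppose that $E$, with its order topology, is locally compact and separable. Let $\mu$ be a Haar measure on $E$. For $t\in E$ let $f^t\in L^\infty(\mu)$ be the class of the characteristic function of $\{u\in E: u>t\}$, let $A$ be the unital (norm closed) $C^*$-subalgebra of the complex algebra $L^\infty(\mu)$ generated by $\{f^t: t\in E\}$, and let $K$ be the compact space of characters of $A$ with the weak-$*$ topology. For $\theta\in K$ and $t\in E$ put $\psi(\theta,t)=\theta(f^t)\in\{0,1\}$, and define $\theta_t,\check\theta\in K$ by $\theta_t(g)=\theta(g_t)$ and $\check\theta(g)=\theta(\check g)$ for $g\in A$, where $g_t(u)=g(u-t)$ and $\check g(u)=g(-u)$ for almost every $u\in E$. Let $B_2$ be the set of those $\theta\in K$ for which $t\mapsto\psi(\theta,t)$ is not continuous on $E$ and there is a point $h(\theta)$ in the closure of $\{t\in E:\psi(\theta,t)=0\}$ with $\psi(\theta,h(\theta))=1$. Then the Borel $\sigma$-algebra of $K\times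 K$ (with the product topology) strictly contains $\mathrm{Bor}(K)\otimes\mathrm{Bor}(K)$. More precisely, $B_2\neq\emptyset$, and for every $\theta\in B_2$ the map $E\to K\times K$, $t\mapsto(\theta_t,(\check\theta)_t)$, is measurable from $\mathrm{Bor}(E)$ to $\mathrm{Bor}(K)\otimes\mathrm{Bor}(K)$ but is not measurable from $\mathrm{Bor}(E)$ to $\mathrm{Bor}(K\times K)$. -/

import Mathlib

open MeasureTheory Set
open scoped ENNReal

noncomputable section

namespace OrderedCharacters

/-! ### The commutative C⋆-algebra `L^∞(μ)` -/

section Linf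

variable {α : Type*} [MeasurableSpace α] {μ : Measure α}

/-- Pointwise (a.e.) multiplication on `L^∞(μ)`. -/
instance linfMul : Mul (Lp ℂ ∞ μ) where
  mul f g := ⟨f.1 * g.1, Lp.mem_Lp_iff_memLp.2
    (((Lp.memLp g).mul' (r := ∞) (Lp.memLp f)).ae_eq (AEEqFun.coeFn_mul f.1 g.1).symm)⟩

/-- The constant function `1` in `L^∞(μ)`. -/
instance linfOne : One (Lp ℂ ∞ μ) where
  one := ⟨1, Lp.mem_Lp_iff_memLp.2
    ((memLp_top_const (1 : ℂ)).ae_eq AEEqFun.coeFn_one.symm)⟩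

theorem linf_coeFn_mul (f g : Lp ℂ ∞ μ) : ⇑(f * g) =ᵐ[μ] fun x => f x * g x :=
  AEEqFun.coeFn_mul f.1 g.1

theorem linf_coeFn_one : ⇑(1 : Lp ℂ ∞ μ) =ᵐ[μ] fun _ => (1 : ℂ) :=
  AEEqFun.coeFn_one

theorem linf_ae_norm_le (f : Lp ℂ ∞ μ) : ∀ᵐ x ∂μ, ‖f x‖ ≤ ‖f‖ := by
  have h := ae_le_eLpNormEssSup (f := f) (μ := μ)
  filter_upwards [h] with x hx
  rw [Lp.norm_def, eLpNorm_exponent_top, ← toReal_enorm]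
  refine ENNReal.toReal_mono ?_ hx
  rw [← eLpNorm_exponent_top]
  exact Lp.eLpNorm_ne_top f

theorem linf_norm_le {f : Lp ℂ ∞ μ} {C : ℝ} (hC : 0 ≤ C) (h : ∀ᵐ x ∂μ, ‖f x‖ ≤ C) :
    ‖f‖ ≤ C := by
  rw [Lp.norm_def, eLpNorm_exponent_top]
  exact ENNReal.toReal_le_of_le_ofReal hC (eLpNormEssSup_le_of_ae_bound h)

instance linfNormedCommRing : NormedCommRing (Lp ℂ ∞ μ) :=
  { (inferInstance : NormedAddCommGroup (Lp ℂ ∞ μ)), linfMul, linfOne with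
    mul_assoc := fun f g h => Subtype.ext (mul_assoc f.1 g.1 h.1)
    mul_comm := fun f g => Subtype.ext (mul_comm f.1 g.1)
    one_mul := fun f => Subtype.ext (one_mul f.1)
    mul_one := fun f => Subtype.ext (mul_one f.1)
    left_distrib := fun f g h => by
      apply Lp.ext
      filter_upwards [linf_coeFn_mul f (g + h), Lp.coeFn_add g h, linf_coeFn_mul f g,
        linf_coeFn_mul f h, Lp.coeFn_add (f * g) (f * h)] with x h1 h2 h3 h4 h5
      refine h1.trans (Eq.trans ?_ h5.symm)
      simp only [h2, Pi.add_apply, h3, h4, mul_add]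
    right_distrib := fun f g h => by
      apply Lp.ext
      filter_upwards [linf_coeFn_mul (f + g) h, Lp.coeFn_add f g, linf_coeFn_mul f h,
        linf_coeFn_mul g h, Lp.coeFn_add (f * h) (g * h)] with x h1 h2 h3 h4 h5
      refine h1.trans (Eq.trans ?_ h5.symm)
      simp only [h2, Pi.add_apply, h3, h4, add_mul]
    zero_mul := fun f => by
      apply Lp.ext
      filter_upwards [linf_coeFn_mul 0 f, Lp.coeFn_zero ℂ ∞ μ] with x h1 h2
      refine h1.trans ?_
      rw [h2]; simp
    mul_zero := fun f => by
      apply Lp.ext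
      filter_upwards [linf_coeFn_mul f 0, Lp.coeFn_zero ℂ ∞ μ] with x h1 h2
      refine h1.trans ?_
      rw [h2]; simp
    norm_mul_le := fun f g => by
      refine linf_norm_le (by positivity) ?_
      filter_upwards [linf_coeFn_mul f g, linf_ae_norm_le f, linf_ae_norm_le g] with x h1 h2 h3
      refine (congrArg norm h1).trans_le ?_
      rw [norm_mul]
      gcongr }

instance linfStarRing : StarRing (Lp ℂ ∞ μ) where
  star_mul f g := by
    apply Lp.ext
    filter_upwards [Lp.coeFn_star (f * g), linf_coeFn_mul f g, linf_coeFn_mul (star g) (star f),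
      Lp.coeFn_star f, Lp.coeFn_star g] with x h1 h2 h3 h4 h5
    rw [h1, h3, Pi.star_apply, h2, h4, h5, Pi.star_apply, Pi.star_apply, star_mul]
  star_add f g := by
    apply Lp.ext
    filter_upwards [Lp.coeFn_star (f + g), Lp.coeFn_add f g, Lp.coeFn_add (star f) (star g),
      Lp.coeFn_star f, Lp.coeFn_star g] with x h1 h2 h3 h4 h5
    rw [h1, h3, Pi.star_apply, h2, Pi.add_apply, Pi.add_apply, h4, h5, Pi.star_apply,
      Pi.star_apply, star_add]

instance linfNormedAlgebra : NormedAlgebra ℂ (Lp ℂ ∞ μ) :=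
  { Algebra.ofModule (R := ℂ) (A := Lp ℂ ∞ μ)
      (fun c f g => by
        apply Lp.ext
        filter_upwards [linf_coeFn_mul (c • f) g, Lp.coeFn_smul c f, Lp.coeFn_smul c (f * g),
          linf_coeFn_mul f g] with x h1 h2 h3 h4
        rw [h1, h3, h2, Pi.smul_apply, Pi.smul_apply, h4, smul_mul_assoc])
      (fun c f g => by
        apply Lp.ext
        filter_upwards [linf_coeFn_mul f (c • g), Lp.coeFn_smul c g, Lp.coeFn_smul c (f * g),
          linf_coeFn_mul f g] with x h1 h2 h3 h4
        rw [h1, h3, h2, Pi.smul_apply, Pi.smul_apply, h4, mul_smul_comm]) with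
    norm_smul_le := fun c f => norm_smul_le c f }

instance linfCStarRing : CStarRing (Lp ℂ ∞ μ) where
  norm_mul_self_le f := by
    have h : ‖f‖ ≤ Real.sqrt ‖star f * f‖ := by
      refine linf_norm_le (Real.sqrt_nonneg _) ?_
      filter_upwards [linf_coeFn_mul (star f) f, Lp.coeFn_star f,
        linf_ae_norm_le (star f * f)] with x h1 h2 h3
      rw [h1, h2, Pi.star_apply, CStarRing.norm_star_mul_self] at h3
      exact Real.le_sqrt_of_sq_le (by rw [sq]; exact h3)
    calc ‖f‖ * ‖f‖ ≤ Real.sqrt ‖star f * f‖ * Real.sqrt ‖star f * f‖ := by gcongr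
      _ = ‖star f * f‖ := Real.mul_self_sqrt (norm_nonneg _)

instance linfStarModule : StarModule ℂ (Lp ℂ ∞ μ) where
  star_smul c f := by
    apply Lp.ext
    filter_upwards [Lp.coeFn_star (c • f), Lp.coeFn_smul c f, Lp.coeFn_smul (star c) (star f),
      Lp.coeFn_star f] with x h1 h2 h3 h4
    rw [h1, h3, Pi.star_apply, h2, Pi.smul_apply, Pi.smul_apply, h4, Pi.star_apply, star_smul]

instance linfCommCStarAlgebra : CommCStarAlgebra (Lp ℂ ∞ μ) where

/-- Composition `g ↦ g ∘ φ` with a measure preserving map, as a ⋆-homomorphism of `L^∞(μ)`. -/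
def linfComp (φ : α → α) (hφ : MeasurePreserving φ μ μ) : Lp ℂ ∞ μ →⋆ₐ[ℂ] Lp ℂ ∞ μ where
  toFun := Lp.compMeasurePreserving φ hφ
  map_one' := rfl
  map_mul' := by rintro ⟨⟨_⟩, _⟩ ⟨⟨_⟩, _⟩; rfl
  map_zero' := map_zero _
  map_add' := map_add _
  commutes' c := by
    rw [Algebra.algebraMap_eq_smul_one]
    exact (Lp.compMeasurePreservingₗ ℂ φ hφ).map_smul c 1
  map_star' := by rintro ⟨⟨_⟩, _⟩; rfl

end Linf

/-! ### The compact space `K` of an ordered space with a measure -/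

section Compact

variable {E : Type*} [LinearOrder E] [TopologicalSpace E] [OrderTopology E]
  [MeasurableSpace E] [BorelSpace E]

theorem memLp_rayFun (μ : Measure E) (t : E) :
    MemLp ((Ioi t).indicator fun _ => (1 : ℂ)) ∞ μ :=
  (memLp_top_const (1 : ℂ)).indicator isOpen_Ioi.measurableSet

/-- `f^t`: the class in `L^∞(μ)` of the characteristic function of `{u | t < u}`. -/
def ray (μ : Measure E) (t : E) : Lp ℂ ∞ μ :=
  (memLp_rayFun μ t).toLp _

/-- `A`: the unital (closed) C⋆-subalgebra of `L^∞(μ)` generated by the `f^t`, `t ∈ E`. -/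
def rayAlgebra (μ : Measure E) : StarSubalgebra ℂ (Lp ℂ ∞ μ) :=
  (StarAlgebra.adjoin ℂ (range (ray μ))).topologicalClosure

instance isClosed_rayAlgebra (μ : Measure E) : IsClosed (rayAlgebra μ : Set (Lp ℂ ∞ μ)) :=
  StarSubalgebra.isClosed_topologicalClosure _

theorem ray_mem (μ : Measure E) (t : E) : ray μ t ∈ rayAlgebra μ :=
  StarSubalgebra.le_topologicalClosure _ (StarAlgebra.subset_adjoin ℂ _ (mem_range_self t))

/-- `K`: the space of characters of `A`, with the weak-⋆ topology. -/
abbrev K (μ : Measure E) : Type _ := WeakDual.characterSpace ℂ (rayAlgebra μ)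

/-- `ψ(θ, t) = θ(f^t)`. -/
def psi {μ : Measure E} (θ : K μ) (t : E) : ℂ := θ ⟨ray μ t, ray_mem μ t⟩

/-- The characters `θ` for which `t ↦ ψ(θ, t)` is continuous. -/
def B₁ (μ : Measure E) : Set (K μ) := {θ | Continuous fun t => psi θ t}

/-- `s` is the discontinuity point `h(θ)`: either `s` is adherent to `{ψ(θ, ·) = 0}` and
`ψ(θ, s) = 1`, or `s` is adherent to `{ψ(θ, ·) = 1}` and `ψ(θ, s) = 0`. -/
def IsJump {μ : Measure E} (θ : K μ) (s : E) : Prop :=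
  (s ∈ closure {t | psi θ t = 0} ∧ psi θ s = 1) ∨ (s ∈ closure {t | psi θ t = 1} ∧ psi θ s = 0)

/-- The characters `θ ∉ B₁` with `ψ(θ, h(θ)) = 1`. -/
def B₂ (μ : Measure E) : Set (K μ) := {θ | θ ∉ B₁ μ ∧ ∃ s, IsJump θ s ∧ psi θ s = 1}

/-- A measure preserving map `φ` such that every `f^t ∘ φ` is in `A` induces a
⋆-endomorphism `g ↦ g ∘ φ` of `A`. -/
theorem linfComp_mem {μ : Measure E} (φ : E → E) (hφ : MeasurePreserving φ μ μ)
    (h : ∀ t, linfComp φ hφ (ray μ t) ∈ rayAlgebra μ) (g : rayAlgebra μ) :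
    linfComp φ hφ g ∈ rayAlgebra μ := by
  have hc : Continuous (linfComp φ hφ) := (Lp.isometry_compMeasurePreserving hφ).continuous
  have hcl : IsClosed ((rayAlgebra μ).comap (linfComp φ hφ) : Set (Lp ℂ ∞ μ)) :=
    (isClosed_rayAlgebra μ).preimage hc
  have hle : rayAlgebra μ ≤ (rayAlgebra μ).comap (linfComp φ hφ) := by
    refine StarSubalgebra.topologicalClosure_minimal (StarAlgebra.adjoin_le ?_) hcl
    rintro _ ⟨t, rfl⟩
    exact h t
  exact hle g.2

/-- The ⋆-endomorphism `g ↦ g ∘ φ` of `A`. -/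
def rayComp {μ : Measure E} (φ : E → E) (hφ : MeasurePreserving φ μ μ)
    (h : ∀ t, linfComp φ hφ (ray μ t) ∈ rayAlgebra μ) : rayAlgebra μ →⋆ₐ[ℂ] rayAlgebra μ :=
  ((linfComp φ hφ).comp (rayAlgebra μ).subtype).codRestrict (rayAlgebra μ)
    (linfComp_mem φ hφ h)

end Compact

/-! ### Translation and reflection when `E` is an ordered group with its Haar measure -/

section Group

variable {E : Type*} [AddCommGroup E] [LinearOrder E] [IsOrderedAddMonoid E]
  [TopologicalSpace E] [OrderTopology E] [MeasurableSpace E] [BorelSpace E]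

theorem measurePreserving_shift (μ : Measure E) [μ.IsAddHaarMeasure] (t : E) :
    MeasurePreserving (fun u : E => u - t) μ μ :=
  measurePreserving_sub_right μ t

theorem linfComp_shift_ray (μ : Measure E) [μ.IsAddHaarMeasure] (t s : E) :
    linfComp _ (measurePreserving_shift μ t) (ray μ s) = ray μ (s + t) := by
  have h : ((Ioi s).indicator fun _ => (1 : ℂ)) ∘ (fun u : E => u - t)
      = (Ioi (s + t)).indicator fun _ => (1 : ℂ) := by
    funext u
    simp [indicator, lt_sub_iff_add_lt]
  change Lp.compMeasurePreserving _ _ ((memLp_rayFun μ s).toLp _) = (memLp_rayFun μ (s + t)).toLp _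
  rw [Lp.toLp_compMeasurePreserving]
  exact MemLp.toLp_congr _ _ (Filter.EventuallyEq.of_eq h)

/-- `θ_t(g) = θ(g_t)`, where `g_t(u) = g(u - t)`. -/
def shift {μ : Measure E} [μ.IsAddHaarMeasure] (θ : K μ) (t : E) : K μ :=
  WeakDual.CharacterSpace.compContinuousMap
    (rayComp (fun u => u - t) (measurePreserving_shift μ t)
      (fun s => by rw [linfComp_shift_ray]; exact ray_mem μ (s + t))) θ

theorem shift_apply {μ : Measure E} [μ.IsAddHaarMeasure] (θ : K μ) (t : E) (g : rayAlgebra μ) :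
    shift θ t g = θ (rayComp (fun u => u - t) (measurePreserving_shift μ t)
      (fun s => by rw [linfComp_shift_ray]; exact ray_mem μ (s + t)) g) := rfl

variable [LocallyCompactSpace E] [TopologicalSpace.SeparableSpace E] [DenselyOrdered E]

theorem measurePreserving_reflect (μ : Measure E) [μ.IsAddHaarMeasure] :
    MeasurePreserving (fun u : E => -u) μ μ := by
  have : SecondCountableTopology E := .of_separableSpace_orderTopology E
  exact Measure.measurePreserving_neg μ

variable [Nontrivial E]

theorem linfComp_reflect_ray (μ : Measure E) [μ.IsAddHaarMeasure] (s : E) :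
    linfComp _ (measurePreserving_reflect μ) (ray μ s) = 1 - ray μ (-s) := by
  have : SecondCountableTopology E := .of_separableSpace_orderTopology E
  have hne : ∀ᵐ u ∂μ, u ≠ -s := by
    rw [ae_iff]; simp
  apply Lp.ext
  have h1 := Lp.coeFn_compMeasurePreserving (ray μ s) (measurePreserving_reflect μ)
  have h2 := (measurePreserving_reflect μ).quasiMeasurePreserving.ae_eq_comp
    (memLp_rayFun μ s).coeFn_toLp
  filter_upwards [h1, h2, (memLp_rayFun μ (-s)).coeFn_toLp, Lp.coeFn_sub 1 (ray μ (-s)),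
    linf_coeFn_one (μ := μ), hne] with u k1 k2 k3 k4 k5 k6
  refine k1.trans (k2.trans ?_)
  rw [k4, Pi.sub_apply, k5, show (ray μ (-s)) u = _ from k3]
  rcases lt_or_gt_of_ne k6 with h | h
  · have h' : s < -u := lt_neg.1 h
    simp [h', h.le]
  · have h' : -u ≤ s := (neg_lt.1 h).le
    simp [h, h']

/-- `θˇ(g) = θ(gˇ)`, where `gˇ(u) = g(-u)`. -/
def reflect {μ : Measure E} [μ.IsAddHaarMeasure] (θ : K μ) : K μ :=
  WeakDual.CharacterSpace.compContinuousMap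
    (rayComp (fun u => -u) (measurePreserving_reflect μ)
      (fun s => by
        rw [linfComp_reflect_ray]
        exact sub_mem (one_mem _) (ray_mem μ (-s)))) θ

/-- The map `t ↦ (θ_t, (θˇ)_t)`. -/
def pairMap {μ : Measure E} [μ.IsAddHaarMeasure] (θ : K μ) (t : E) : K μ × K μ :=
  (shift θ t, shift (reflect θ) t)

end Group

end OrderedCharacters

end

open MeasureTheory Set Filter Topology
open scoped ENNReal Cardinal

namespace OrderedCharacters

noncomputable section

/-! ### Borel sets and one-sided neighbourhoods -/

section OneSided

variable {E : Type*} [LinearOrder E] [TopologicalSpace E] [OrderTopology E]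
  [SecondCountableTopology E] [DenselyOrdered E] [MeasurableSpace E] [BorelSpace E]

/-! For `θ ∈ B₂ μ` the function `psi θ` is the indicator of a closed ray `Iic h`, and `K μ` carries
the topology of pointwise convergence of `psi` (`isEmbedding_psi`). Hence `t ↦ θ_t` is continuous
from the left. Reflection reverses the ray, so `t ↦ θˇ_t` is continuous from the right. Each
one-sided continuous map is Borel, and so the pair is measurable for the product σ-algebra.

The two coordinates together are as in the Sorgenfrey plane: one detects `t ≤ a` and the other `a ≤
t` by clopen conditions, so every singleton, and then every subset of `E`, is the preimage of an
open subset of `K μ × K μ` (`exists_isOpen_preimage_pairMap_eq`). As `E` has a non-Borel subset, by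
counting, the pair is not Borel for the product topology. Since `B₂ μ` is nonempty, the two
σ-algebras differ. -/

theorem measurableSet_of_forall_mem_nhdsLE [NoMinOrder E] {S : Set E}
    (hS : ∀ x ∈ S, S ∈ 𝓝[≤] x) : MeasurableSet S := by
  choose! a ha hsub using fun x hx => mem_nhdsLE_iff_exists_Ioc_subset.1 (hS x hx)
  -- The intervals `Ioo (a x) x` at non-interior points are disjoint: for `x < y`, having `a y < x`
  -- would put `x` in the interior of `S`. Second countability then allows only countably many.
  have hcount : (S \ interior S).Countable := by
    refine PairwiseDisjoint.countable_of_isOpen (s := fun x => Ioo (a x) x) ?_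
      (fun _ _ => isOpen_Ioo) fun x hx => nonempty_Ioo.2 (ha x hx.1)
    have key : ∀ x ∈ S \ interior S, ∀ y ∈ S \ interior S, x < y →
        Disjoint (Ioo (a x) x) (Ioo (a y) y) := by
      intro x hx y hy hxy
      have hle : x ≤ a y := by
        by_contra! h
        exact hx.2 (mem_interior.2
          ⟨Ioo (a y) y, Ioo_subset_Ioc_self.trans (hsub y hy.1), isOpen_Ioo, h, hxy⟩)
      exact Set.disjoint_left.2 fun u hu hu' => (hu.2.trans_le hle).not_gt hu'.1
    intro x hx y hy hxy
    rcases lt_or_gt_of_ne hxy with h | h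
    · exact key x hx y hy h
    · exact (key y hy x hx h).symm
  rw [← union_sdiff_cancel (interior_subset (s := S))]
  exact isOpen_interior.measurableSet.union hcount.measurableSet

theorem measurableSet_of_forall_mem_nhdsGE [NoMaxOrder E] {S : Set E}
    (hS : ∀ x ∈ S, S ∈ 𝓝[≥] x) : MeasurableSet S :=
  measurableSet_of_forall_mem_nhdsLE (E := Eᵒᵈ) hS

theorem measurable_of_continuousWithinAt_Iic [NoMinOrder E] {X : Type*} [TopologicalSpace X]
    {f : E → X} (hf : ∀ x, ContinuousWithinAt f (Iic x) x) : Measurable[_, borel X] f :=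
  measurable_generateFrom fun _ hU =>
    measurableSet_of_forall_mem_nhdsLE fun x hx => hf x (hU.mem_nhds hx)

theorem measurable_of_continuousWithinAt_Ici [NoMaxOrder E] {X : Type*} [TopologicalSpace X]
    {f : E → X} (hf : ∀ x, ContinuousWithinAt f (Ici x) x) : Measurable[_, borel X] f :=
  measurable_generateFrom fun _ hU =>
    measurableSet_of_forall_mem_nhdsGE fun x hx => hf x (hU.mem_nhds hx)

end OneSided

/-! ### Existence of non-Borel sets -/

/-- A countably generated σ-algebra has at most `𝔠` members, fewer than the power set by Cantor's
theorem. -/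
theorem exists_not_measurableSet_of_continuum_le {α : Type*} [MeasurableSpace α]
    [MeasurableSpace.CountablyGenerated α] (h : 𝔠 ≤ #α) : ∃ S : Set α, ¬ MeasurableSet S := by
  by_contra! hall
  obtain ⟨b, hb, hgen⟩ := MeasurableSpace.CountablyGenerated.isCountablyGenerated (α := α)
  have hle := MeasurableSpace.cardinal_measurableSet_le_continuum
    (s := b) ((Cardinal.le_aleph0_iff_set_countable.2 hb).trans Cardinal.aleph0_le_continuum)
  rw [← hgen] at hle
  have huniv : {t : Set α | MeasurableSet t} = univ := eq_univ_of_forall hall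
  have hset : #(Set α) ≤ 𝔠 := by
    rw [← Cardinal.mk_univ, ← huniv]
    exact hle
  rw [Cardinal.mk_set] at hset
  exact ((Cardinal.cantor #α).trans_le (hset.trans h)).false

/-- The compact set is metrizable, hence Polish, and an uncountable Polish space contains a copy of
the Cantor space. -/
theorem continuum_le_mk_of_isCompact {X : Type*} [TopologicalSpace X] [T2Space X]
    [SecondCountableTopology X] {C : Set X} (hC : IsCompact C) (hunc : ¬ C.Countable) :
    𝔠 ≤ #X := by
  have : CompactSpace C := isCompact_iff_compactSpace.1 hC
  let := TopologicalSpace.metrizableSpaceMetric C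
  have : PolishSpace C := inferInstance
  have hunc' : ¬ (univ : Set C).Countable := by
    rwa [countable_univ_iff, countable_coe_iff]
  obtain ⟨f, -, -, hf⟩ := isClosed_univ.exists_nat_bool_injection_of_not_countable hunc'
  have h := Cardinal.mk_le_of_injective
    (f := fun x : ULift (ℕ → Bool) => (f x.down : X))
    (fun x y hxy => ULift.ext _ _ (hf (Subtype.ext hxy)))
  simpa using h

/-- A compact neighbourhood of `0` has positive measure while points are null, so it is uncountable.
-/
theorem exists_not_measurableSet_of_isAddHaarMeasure {E : Type*} [AddGroup E] [TopologicalSpace E]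
    [IsTopologicalAddGroup E] [T2Space E] [LocallyCompactSpace E] [SecondCountableTopology E]
    [MeasurableSpace E] [BorelSpace E] (μ : Measure E) [μ.IsAddHaarMeasure] [NullSingletonClass μ] :
    ∃ S : Set E, ¬ MeasurableSet S := by
  obtain ⟨C, hC, hC0⟩ := exists_compact_mem_nhds (0 : E)
  refine exists_not_measurableSet_of_continuum_le (continuum_le_mk_of_isCompact hC fun hcount => ?_)
  exact (Measure.measure_pos_of_mem_nhds μ hC0).ne' (hcount.measure_zero μ)

/-! ### Limits along ultrafilters as characters of `L^∞` -/

section Ultralimit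

variable {α : Type*} [MeasurableSpace α] {μ : Measure α}

theorem exists_tendsto_ultrafilter (U : Ultrafilter α) (hU : (U : Filter α) ≤ ae μ)
    (g : Lp ℂ ∞ μ) : ∃ z : ℂ, Tendsto g U (𝓝 z) := by
  have hmem : Metric.closedBall (0 : ℂ) ‖g‖ ∈ U.map g := by
    refine hU ?_
    filter_upwards [linf_ae_norm_le g] with x hx
    simpa using hx
  obtain ⟨z, -, hz⟩ := (isCompact_closedBall (0 : ℂ) ‖g‖).ultrafilter_le_nhds (U.map g)
    (le_principal_iff.2 hmem)
  exact ⟨z, hz⟩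

/-- The limit of the elements of `L^∞(μ)` along an ultrafilter finer than the a.e. filter. -/
def ultralimit (U : Ultrafilter α) (hU : (U : Filter α) ≤ ae μ) (g : Lp ℂ ∞ μ) : ℂ :=
  (exists_tendsto_ultrafilter U hU g).choose

theorem tendsto_ultralimit (U : Ultrafilter α) (hU : (U : Filter α) ≤ ae μ) (g : Lp ℂ ∞ μ) :
    Tendsto g U (𝓝 (ultralimit U hU g)) :=
  (exists_tendsto_ultrafilter U hU g).choose_spec

theorem ultralimit_eq {U : Ultrafilter α} (hU : (U : Filter α) ≤ ae μ) {g : Lp ℂ ∞ μ}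
    {f : α → ℂ} {z : ℂ} (hgf : g =ᵐ[μ] f) (hf : Tendsto f U (𝓝 z)) : ultralimit U hU g = z :=
  tendsto_nhds_unique (tendsto_ultralimit U hU g) (hf.congr' (hU hgf.symm))

/-- The limit along an ultrafilter, as a homomorphism `L^∞(μ) → ℂ`. -/
def ultralimitHom (U : Ultrafilter α) (hU : (U : Filter α) ≤ ae μ) : Lp ℂ ∞ μ →ₐ[ℂ] ℂ where
  toFun := ultralimit U hU
  map_one' := ultralimit_eq hU linf_coeFn_one tendsto_const_nhds
  map_mul' f g := ultralimit_eq hU (linf_coeFn_mul f g)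
    ((tendsto_ultralimit U hU f).mul (tendsto_ultralimit U hU g))
  map_zero' := ultralimit_eq hU (Lp.coeFn_zero ℂ ∞ μ) tendsto_const_nhds
  map_add' f g := ultralimit_eq hU (Lp.coeFn_add f g)
    ((tendsto_ultralimit U hU f).add (tendsto_ultralimit U hU g))
  commutes' c := by
    rw [Algebra.algebraMap_eq_smul_one, Algebra.algebraMap_eq_smul_one]
    refine ultralimit_eq hU (Lp.coeFn_smul c (1 : Lp ℂ ∞ μ)) ?_
    refine (tendsto_const_nhds (x := (1 : ℂ))).const_smul c |>.congr' (hU ?_)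
    filter_upwards [linf_coeFn_one (μ := μ)] with x hx
    simp [hx]

end Ultralimit

/-! ### Characters and the functions `ψ(θ, ·)` -/

section Psi

variable {E : Type*} [LinearOrder E] [TopologicalSpace E] [OrderTopology E]
  [MeasurableSpace E] [BorelSpace E] {μ : Measure E}

theorem ray_mul_ray (s t : E) : ray μ s * ray μ t = ray μ (max s t) := by
  apply Lp.ext
  filter_upwards [linf_coeFn_mul (ray μ s) (ray μ t), (memLp_rayFun μ s).coeFn_toLp,
    (memLp_rayFun μ t).coeFn_toLp, (memLp_rayFun μ (max s t)).coeFn_toLp] with u h1 h2 h3 h4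
  rw [h1]
  refine (congrArg₂ (· * ·) h2 h3).trans (Eq.trans ?_ h4.symm)
  by_cases hs : s < u <;> by_cases ht : t < u <;> simp [hs, ht, indicator]

/-- This identity makes `psi θ` both `{0, 1}`-valued (take `s = t`) and decreasing. -/
theorem psi_mul_psi (θ : K μ) (s t : E) : psi θ s * psi θ t = psi θ (max s t) := by
  rw [psi, psi, ← map_mul]
  exact congrArg θ (Subtype.ext (ray_mul_ray s t))

theorem psi_eq_zero_or_one (θ : K μ) (t : E) : psi θ t = 0 ∨ psi θ t = 1 := by
  have h := psi_mul_psi θ t t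
  rw [max_self] at h
  exact IsIdempotentElem.iff_eq_zero_or_one.1 h

theorem psi_eq_one_of_le {θ : K μ} {s t : E} (hst : s ≤ t) (ht : psi θ t = 1) :
    psi θ s = 1 := by
  have h := psi_mul_psi θ s t
  rwa [max_eq_right hst, ht, mul_one] at h

theorem continuous_psi (t : E) : Continuous fun θ : K μ => psi θ t :=
  (WeakDual.eval_continuous _).comp continuous_subtype_val

/-- Characters are continuous, and the ⋆-algebra generated by the rays is dense in `rayAlgebra μ`.
-/
theorem psi_injective : Function.Injective (psi : K μ → E → ℂ) := by
  intro θ η h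
  refine StarAlgHomClass.ext_topologicalClosure (R := ℂ) (map_continuous θ) (map_continuous η)
    fun x => ?_
  induction x using StarAlgebra.adjoin_induction_subtype with
  | mem y hy =>
    obtain ⟨t, rfl⟩ := hy
    exact congrFun h t
  | algebraMap r => exact (AlgHomClass.commutes θ r).trans (AlgHomClass.commutes η r).symm
  | add y z hy hz =>
    exact (map_add θ _ _).trans ((congrArg₂ (· + ·) hy hz).trans (map_add η _ _).symm)
  | mul y z hy hz =>
    exact (map_mul θ _ _).trans ((congrArg₂ (· * ·) hy hz).trans (map_mul η _ _).symm)
  | star y hy => exact (map_star θ _).trans ((congrArg star hy).trans (map_star η _).symm)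

instance compactSpace_K : CompactSpace (K μ) :=
  have : CompleteSpace (rayAlgebra μ) := (isClosed_rayAlgebra μ).completeSpace_coe
  inferInstance

theorem isEmbedding_psi : IsEmbedding (psi : K μ → E → ℂ) :=
  ((continuous_pi continuous_psi).isClosedEmbedding psi_injective).isEmbedding

/-- The character is a limit at `x` from the right, along an ultrafilter that also refines `ae μ` so
that it is defined on classes. Such an ultrafilter exists because no interval `Ioo x b` is null. -/
theorem exists_psi_eq_ite [NoMaxOrder E] [DenselyOrdered E] [μ.IsOpenPosMeasure] (x : E) :
    ∃ θ : K μ, ∀ s, psi θ s = if s ≤ x then 1 else 0 := by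
  have hne : (𝓝[>] x ⊓ ae μ).NeBot := by
    rw [inf_neBot_iff]
    intro V hV W hW
    obtain ⟨b, hb, hbV⟩ := mem_nhdsGT_iff_exists_Ioo_subset.1 hV
    have hpos : 0 < μ (Ioo x b) := isOpen_Ioo.measure_pos μ (nonempty_Ioo.2 hb)
    by_contra hemp
    refine hpos.ne' (measure_mono_null (fun u hu hW' => hemp ⟨u, hbV hu, hW'⟩) hW)
  let U := Ultrafilter.of (𝓝[>] x ⊓ ae μ)
  have hU : (U : Filter E) ≤ 𝓝[>] x ⊓ ae μ := Ultrafilter.of_le _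
  have hae : (U : Filter E) ≤ ae μ := hU.trans inf_le_right
  have hgt : (U : Filter E) ≤ 𝓝[>] x := hU.trans inf_le_left
  refine ⟨WeakDual.CharacterSpace.equivAlgHom.symm
    ((ultralimitHom U hae).comp (rayAlgebra μ).subtype.toAlgHom), fun s => ?_⟩
  refine ultralimit_eq hae (memLp_rayFun μ s).coeFn_toLp ?_
  refine tendsto_const_nhds.congr' (hgt ?_)
  split_ifs with hs
  · filter_upwards [self_mem_nhdsWithin] with u hu
    simp [hs.trans_lt hu]
  · filter_upwards [Ioo_mem_nhdsGT (not_le.1 hs)] with u hu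
    simp [hu.2.le]

theorem exists_forall_psi_eq_ite_of_mem_B₂ {θ : K μ} (hθ : θ ∈ B₂ μ) :
    ∃ h, ∀ s, psi θ s = if s ≤ h then 1 else 0 := by
  obtain ⟨-, h, hjump, h1⟩ := hθ
  have hcl : h ∈ closure {t | psi θ t = 0} := by
    rcases hjump with hj | hj
    · exact hj.1
    · exact absurd (hj.2.symm.trans h1) zero_ne_one
  refine ⟨h, fun s => ?_⟩
  split_ifs with hs
  · exact psi_eq_one_of_le hs h1
  · refine (psi_eq_zero_or_one θ s).resolve_right fun hs1 => ?_
    obtain ⟨u, hu, hu0⟩ := mem_closure_iff.1 hcl (Iio s) isOpen_Iio (not_le.1 hs)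
    exact zero_ne_one (hu0.symm.trans (psi_eq_one_of_le (le_of_lt hu) hs1))

theorem mem_B₂_of_psi_eq_ite [NoMaxOrder E] [DenselyOrdered E] {θ : K μ} {h : E}
    (hθ : ∀ s, psi θ s = if s ≤ h then 1 else 0) : θ ∈ B₂ μ := by
  have h1 : psi θ h = 1 := by simp [hθ]
  have hcl : h ∈ closure {t | psi θ t = 0} := by
    have hset : {t | psi θ t = 0} = Ioi h := by ext t; simp [hθ]
    rw [hset, closure_Ioi]
    exact self_mem_Ici
  refine ⟨fun hcont => ?_, h, Or.inl ⟨hcl, h1⟩, h1⟩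
  have hclosed : IsClosed {t | psi θ t = 0} := isClosed_eq hcont continuous_const
  rw [hclosed.closure_eq] at hcl
  exact zero_ne_one (Eq.trans (Eq.symm hcl) h1)

theorem B₂_nonempty [Nonempty E] [NoMaxOrder E] [DenselyOrdered E] [μ.IsOpenPosMeasure] :
    (B₂ μ).Nonempty :=
  have ⟨θ, hθ⟩ := exists_psi_eq_ite (μ := μ) (Classical.arbitrary E)
  ⟨θ, mem_B₂_of_psi_eq_ite hθ⟩

end Psi

/-! ### The map `t ↦ (θ_t, θˇ_t)` -/

section Group

variable {E : Type*} [AddCommGroup E] [LinearOrder E] [IsOrderedAddMonoid E]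
  [TopologicalSpace E] [OrderTopology E] [MeasurableSpace E] [BorelSpace E]
  {μ : Measure E} [μ.IsAddHaarMeasure]

theorem psi_shift (θ : K μ) (t s : E) : psi (shift θ t) s = psi θ (s + t) :=
  congrArg θ (Subtype.ext (linfComp_shift_ray μ t s))

/-- For fixed `s` the coordinate is the indicator of `t ≤ h - s`, which is locally constant to the
left of every point. -/
theorem continuousWithinAt_shift {θ : K μ} {h : E}
    (hθ : ∀ s, psi θ s = if s ≤ h then 1 else 0) (x : E) :
    ContinuousWithinAt (shift θ) (Iic x) x := by
  rw [isEmbedding_psi.isInducing.continuousWithinAt_iff, continuousWithinAt_pi]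
  intro s
  simp only [Function.comp_apply, psi_shift, hθ, ← le_sub_iff_add_le']
  refine tendsto_const_nhds.congr' ?_
  by_cases hx : x ≤ h - s
  · filter_upwards [self_mem_nhdsWithin] with t ht
    rw [if_pos hx, if_pos (le_trans ht hx)]
  · filter_upwards [mem_nhdsWithin_of_mem_nhds (Ioi_mem_nhds (not_le.1 hx))] with t ht
    rw [if_neg hx, if_neg (not_le.2 ht)]

variable [LocallyCompactSpace E] [TopologicalSpace.SeparableSpace E] [DenselyOrdered E]
  [Nontrivial E]

theorem psi_reflect (θ : K μ) (s : E) : psi (reflect θ) s = 1 - psi θ (-s) := by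
  have h : psi (reflect θ) s = θ (1 - ⟨ray μ (-s), ray_mem μ (-s)⟩) :=
    congrArg θ (Subtype.ext (linfComp_reflect_ray μ s))
  rw [h, map_sub, map_one, psi]

theorem psi_shift_reflect {θ : K μ} {h : E}
    (hθ : ∀ s, psi θ s = if s ≤ h then 1 else 0) (t s : E) :
    psi (shift (reflect θ) t) s = if -h - s ≤ t then 0 else 1 := by
  have hiff : -(s + t) ≤ h ↔ -h - s ≤ t := by
    rw [neg_le, sub_le_iff_le_add, add_comm]
  rw [psi_shift, psi_reflect, hθ]
  simp only [hiff]
  split_ifs <;> simp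

theorem continuousWithinAt_shift_reflect {θ : K μ} {h : E}
    (hθ : ∀ s, psi θ s = if s ≤ h then 1 else 0) (x : E) :
    ContinuousWithinAt (shift (reflect θ)) (Ici x) x := by
  rw [isEmbedding_psi.isInducing.continuousWithinAt_iff, continuousWithinAt_pi]
  intro s
  simp only [Function.comp_apply, psi_shift_reflect hθ]
  refine tendsto_const_nhds.congr' ?_
  by_cases hx : -h - s ≤ x
  · filter_upwards [self_mem_nhdsWithin] with t ht
    rw [if_pos hx, if_pos (le_trans hx ht)]
  · filter_upwards [mem_nhdsWithin_of_mem_nhds (Iio_mem_nhds (not_le.1 hx))] with t ht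
    rw [if_neg hx, if_neg (not_le.2 ht)]

theorem measurable_pairMap {θ : K μ} (hθ : θ ∈ B₂ μ) :
    Measurable[borel E, (borel (K μ)).prod (borel (K μ))] (pairMap θ) := by
  have : SecondCountableTopology E := .of_separableSpace_orderTopology E
  obtain ⟨h, hh⟩ := exists_forall_psi_eq_ite_of_mem_B₂ hθ
  rw [← BorelSpace.measurable_eq (α := E)]
  let : MeasurableSpace (K μ) := borel (K μ)
  exact Measurable.prodMk (measurable_of_continuousWithinAt_Iic (continuousWithinAt_shift hh))
    (measurable_of_continuousWithinAt_Ici (continuousWithinAt_shift_reflect hh))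

/-- At `s = h - a` the first coordinate tests `t ≤ a`; at `s = -h - a` the second tests `a ≤ t`.
Each `a ∈ S` thus contributes an open set with preimage `{a}`, and an arbitrary union of these is
still open. -/
theorem exists_isOpen_preimage_pairMap_eq {θ : K μ} (hθ : θ ∈ B₂ μ) (S : Set E) :
    ∃ U : Set (K μ × K μ), IsOpen U ∧ pairMap θ ⁻¹' U = S := by
  obtain ⟨h, hh⟩ := exists_forall_psi_eq_ite_of_mem_B₂ hθ
  refine ⟨⋃ a ∈ S, {p | psi p.1 (h - a) ≠ 0 ∧ psi p.2 (-h - a) ≠ 1}, ?_, ?_⟩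
  · refine isOpen_biUnion fun a _ => IsOpen.inter ?_ ?_
    · exact isOpen_ne_fun ((continuous_psi _).comp continuous_fst) continuous_const
    · exact isOpen_ne_fun ((continuous_psi _).comp continuous_snd) continuous_const
  · have hsingle : ∀ a t : E, (psi (shift θ t) (h - a) ≠ 0 ∧
        psi (shift (reflect θ) t) (-h - a) ≠ 1) ↔ t = a := by
      intro a t
      rw [psi_shift, hh, psi_shift_reflect hh, le_antisymm_iff]
      have h1 : h - a + t ≤ h ↔ t ≤ a := by rw [sub_add_eq_add_sub, sub_le_iff_le_add]; simp
      simp [h1]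
    ext t
    simp [pairMap, hsingle]

theorem not_measurable_pairMap {θ : K μ} (hθ : θ ∈ B₂ μ) :
    ¬ Measurable[borel E, borel (K μ × K μ)] (pairMap θ) := by
  have : SecondCountableTopology E := .of_separableSpace_orderTopology E
  intro hmeas
  obtain ⟨S, hS⟩ := exists_not_measurableSet_of_isAddHaarMeasure μ
  obtain ⟨U, hU, rfl⟩ := exists_isOpen_preimage_pairMap_eq hθ S
  rw [← BorelSpace.measurable_eq (α := E)] at hmeas
  exact hS (hmeas (MeasurableSpace.measurableSet_generateFrom hU))

end Group

theorem borel_prod_borel_le (X Y : Type*) [TopologicalSpace X] [TopologicalSpace Y] :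
    (borel X).prod (borel Y) ≤ borel (X × Y) :=
  sup_le continuous_fst.borel_measurable.comap_le continuous_snd.borel_measurable.comap_le

end

end OrderedCharacters

theorem mainTheorem12 {E : Type*} [AddCommGroup E] [LinearOrder E] [IsOrderedAddMonoid E]
    [TopologicalSpace E] [OrderTopology E] [LocallyCompactSpace E]
    [TopologicalSpace.SeparableSpace E] [DenselyOrdered E] [Nontrivial E]
    [MeasurableSpace E] [BorelSpace E] (μ : MeasureTheory.Measure E) [μ.IsAddHaarMeasure] :
    (borel (OrderedCharacters.K μ)).prod (borel (OrderedCharacters.K μ))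
        < borel (OrderedCharacters.K μ × OrderedCharacters.K μ) ∧
      (OrderedCharacters.B₂ μ).Nonempty ∧
      ∀ θ ∈ OrderedCharacters.B₂ μ,
        Measurable[borel E, (borel (OrderedCharacters.K μ)).prod (borel (OrderedCharacters.K μ))]
            (OrderedCharacters.pairMap θ) ∧
          ¬ Measurable[borel E, borel (OrderedCharacters.K μ × OrderedCharacters.K μ)]
            (OrderedCharacters.pairMap θ) := by
  refine ⟨lt_of_le_of_ne (OrderedCharacters.borel_prod_borel_le _ _) fun heq => ?_,
    OrderedCharacters.B₂_nonempty, fun θ hθ => ⟨OrderedCharacters.measurable_pairMap hθ,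
      OrderedCharacters.not_measurable_pairMap hθ⟩⟩
  obtain ⟨θ, hθ⟩ := OrderedCharacters.B₂_nonempty (μ := μ)
  exact OrderedCharacters.not_measurable_pairMap hθ
    (heq ▸ OrderedCharacters.measurable_pairMap hθ)
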